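/- Let $n\ge 0$ and let $A_n$ be the $n$th Laver table, that is, the set $\{1,\dots,2^n\}$ with the unique binary operation $\star$ satisfying $p\star 1=p+1 \bmod 2^n$ (residues taken in $\{1,\dots,2^n\}$) and $p\star(q\star 1)=(p\star q)\star(p\star 1)$ for all $p,q$. For $k\ge 0$ let $C_k$ be the free abelian group on $A_n^k$, let $\partial_k:C_k\to C_{k-1}$ ($k\ge1$) be the rack differential $$\partial_k(x_1,\dots,x_k)=\sum_{i=1}^{k}(-1)^{i-1}\bigl[(x_1,\dots,x_{i-1},x_i\star x_{i+1},\dots,x_i\star x_k)-(x_1,\dots,x_{i-1},x_{i+1},\dots,x_k)\bigr],$$ and call $\phi\in\mathrm{Hom}(C_2,\mathbb Z)$ a ($\mathbb Z$-valued rack) 2-cocycle if $\phi\circ\partial_3=0$, and a 2-coboundary if $\phi=\theta\circ\partial_2$ for some $\theta\in\mathrm{Hom}(C_1,\mathbb Z)$. Identify maps $A_n\times A_n\to\mathbb Z$ with elements of $\mathrm{Hom}(C_2,\mathbb Z)$ by linear extension. Then the 2-cocycles of $A_n$ form a free $\mathbb Z$-module of rank $2^n$. For $1\le q<2^n$, the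 map $\psi_{q,n}:A_n\times A_n\to\{0,1\}$ defined by $$\psi_{q,n}(x,y)=\begin{cases}1&\text{if } q=p\star y \text{ for some } p\in A_n, \text{ but } q\neq p\star (x\star y)\text{ for all } p\in A_n,\\ 0&\text{otherwise,}\end{cases}$$ is a 2-coboundary, and the $2^n-1$ maps $\psi_{q,n}$ ($1\le q<2^n$) together with the constant map $1$ form a basis of the $\mathbb Z$-module of 2-cocycles. -/

import Mathlib

/-! ### Laver tables -/

/-- Recursive computation of the `N`-element table on `{1, …, N}`: for `1 ≤ p ≤ N`,
`laverAux N p q` is the value `p ⋆ (q + 1)` (the second argument is shifted by one).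
The row of `N` is the identity; the row of `p < N` starts with `p ⋆ 1 = p + 1` and continues by
`p ⋆ (q + 2) = (p ⋆ (q + 1)) ⋆ (p + 1)`. The recursion makes sense because all values in the
row of `p < N` are larger than `p`, which is recorded in the type of the result. -/
def laverAux (N p q : ℕ) :
    {r : ℕ // (p < N → p < r ∧ r ≤ N) ∧ (N ≤ p → r = q + 1)} :=
  if h : p < N then
    match q with
    | 0 => ⟨p + 1, fun _ => ⟨by omega, by omega⟩, fun h' => by omega⟩
    | q + 1 =>
      match laverAux N p q with
      | ⟨r, hr⟩ =>
        match laverAux N r p with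
        | ⟨s, hs⟩ => ⟨s, fun _ => by
            have hr1 := hr.1 h
            rcases Nat.lt_or_ge r N with h1 | h1
            · have := hs.1 h1
              omega
            · have := hs.2 h1
              omega, fun h' => by omega⟩
  else ⟨q + 1, fun h' => absurd h' h, fun _ => rfl⟩
termination_by (N - p, q)
decreasing_by
  · exact Prod.Lex.right _ (Nat.lt_succ_self q)
  · apply Prod.Lex.left
    have := hr.1 h
    omega

/-- The underlying set `{1, …, 2 ^ n}` of the `n`th Laver table. -/
abbrev LaverTable (n : ℕ) : Type := Set.Icc 1 (2 ^ n)

namespace LaverTable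

variable {n : ℕ}

/-- The operation `⋆` of the `n`th Laver table `A_n`. -/
def op (x y : LaverTable n) : LaverTable n :=
  ⟨(laverAux (2 ^ n) x.1 (y.1 - 1)).1, by
    obtain ⟨x, hx1, hx2⟩ := x
    obtain ⟨y, hy1, hy2⟩ := y
    have h := (laverAux (2 ^ n) x (y - 1)).2
    show 1 ≤ (laverAux (2 ^ n) x (y - 1)).1 ∧ (laverAux (2 ^ n) x (y - 1)).1 ≤ 2 ^ n
    rcases Nat.lt_or_ge x (2 ^ n) with h1 | h1
    · have := h.1 h1
      omega
    · have := h.2 h1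
      omega⟩

/-- The element `1` of `A_n`. -/
def one (n : ℕ) : LaverTable n := ⟨1, le_refl 1, Nat.one_le_two_pow⟩

/-- `p ⋆ 1 = p + 1 mod 2 ^ n`, the residues being taken in `{1, …, 2 ^ n}`. -/
theorem op_one (p : LaverTable n) :
    (op p (one n)).1 = if p.1 < 2 ^ n then p.1 + 1 else 1 := by
  show (laverAux (2 ^ n) p.1 0).1 = _
  rw [laverAux]
  split_ifs <;> rfl

/-- The row of `2 ^ n` is the identity. -/
theorem op_of_last (p q : LaverTable n) (hp : p.1 = 2 ^ n) : op p q = q := by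
  apply Subtype.ext
  have h := (laverAux (2 ^ n) p.1 (q.1 - 1)).2.2 hp.ge
  have hq := q.2.1
  show (laverAux (2 ^ n) p.1 (q.1 - 1)).1 = q.1
  omega

theorem lt_op (p q : LaverTable n) (hp : p.1 < 2 ^ n) : p.1 < (op p q).1 :=
  ((laverAux (2 ^ n) p.1 (q.1 - 1)).2.1 hp).1

/-- The recursion rule `p ⋆ (q ⋆ 1) = (p ⋆ q) ⋆ (p ⋆ 1)` that defines the table. -/
theorem op_op_one (p q : LaverTable n) (hq : q.1 < 2 ^ n) :
    op p (op q (one n)) = op (op p q) (op p (one n)) := by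
  rcases Nat.lt_or_ge p.1 (2 ^ n) with hp | hp
  · have h1 := op_one p
    have h2 := op_one q
    rw [if_pos hp] at h1
    rw [if_pos hq] at h2
    have hq1 := q.2.1
    apply Subtype.ext
    show (laverAux (2 ^ n) p.1 ((op q (one n)).1 - 1)).1 =
      (laverAux (2 ^ n) (laverAux (2 ^ n) p.1 (q.1 - 1)).1 ((op p (one n)).1 - 1)).1
    rw [h1, h2, Nat.add_sub_cancel, Nat.add_sub_cancel]
    obtain ⟨k, hk⟩ : ∃ k, q.1 = k + 1 := ⟨q.1 - 1, by omega⟩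
    rw [hk, Nat.add_sub_cancel, laverAux, dif_pos hp]
  · have hp' : p.1 = 2 ^ n := le_antisymm p.2.2 hp
    rw [op_of_last p _ hp', op_of_last p _ hp', op_of_last p _ hp']

/-- `op` is the only operation on `{1, …, 2 ^ n}` that can satisfy the two defining equations of
the Laver table: `p ⋆ 1 = p + 1 mod 2 ^ n` and `p ⋆ (q ⋆ 1) = (p ⋆ q) ⋆ (p ⋆ 1)`. -/
theorem op_unique (f : LaverTable n → LaverTable n → LaverTable n)
    (h1 : ∀ p, (f p (one n)).1 = if p.1 < 2 ^ n then p.1 + 1 else 1)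
    (h2 : ∀ p q, f p (f q (one n)) = f (f p q) (f p (one n))) : f = op := by
  have e1 : ∀ p, f p (one n) = op p (one n) := fun p =>
    Subtype.ext ((h1 p).trans (op_one p).symm)
  have step : ∀ p : LaverTable n,
      (∀ q : LaverTable n, q.1 < 2 ^ n → f p q = op p q →
        f (op p q) (op p (one n)) = op (op p q) (op p (one n))) →
      ∀ (k : ℕ) (q : LaverTable n), q.1 = k + 1 → f p q = op p q := by
    intro p hp k
    induction k with
    | zero =>
      intro q hq
      obtain rfl : q = one n := Subtype.ext hq
      exact e1 p
    | succ k ih =>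
      intro q hq
      have hq2 := q.2.2
      let r : LaverTable n := ⟨k + 1, by omega, by omega⟩
      have hr : r.1 < 2 ^ n := by show k + 1 < 2 ^ n; omega
      have hqr : q = op r (one n) := by
        apply Subtype.ext
        rw [op_one, if_pos hr]
        exact hq
      have hfr := ih r rfl
      rw [hqr, op_op_one p r hr, ← hp r hr hfr, ← hfr, ← e1 r, ← e1 p, h2]
  have main : ∀ (d : ℕ) (p : LaverTable n), 2 ^ n - p.1 = d → ∀ q, f p q = op p q := by
    intro d
    induction d using Nat.strong_induction_on with
    | _ d ih =>
      intro p hd q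
      have hq1 := q.2.1
      refine step p (fun r hr hfr => ?_) (q.1 - 1) q (by omega)
      rcases Nat.lt_or_ge p.1 (2 ^ n) with hp | hp
      · have := lt_op p r hp
        exact ih _ (by omega) (op p r) rfl _
      · have hp' : p.1 = 2 ^ n := le_antisymm p.2.2 hp
        have h3 : op p (one n) = one n := op_of_last p _ hp'
        rw [h3, e1]
  funext p q
  exact main _ p rfl q

/-- `q` appears in the column of `y` in the table `A_n`. -/
def InColumn (q : ℕ) (y : LaverTable n) : Prop := ∃ p : LaverTable n, (op p y).1 = q

open Classical in
/-- The map `ψ_{q,n}` on `{1, …, 2 ^ n} × {1, …, 2 ^ n}`. -/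
noncomputable def psi (n q : ℕ) (x y : LaverTable n) : ℤ :=
  if InColumn q y ∧ ¬ InColumn q (op x y) then 1 else 0

end LaverTable

/-! ### The rack complex of a set with a binary operation -/

namespace RackComplex

variable {S : Type*} (m : S → S → S)

/-- `C_k(S)`, the free abelian group based on `S ^ k`. -/
abbrev Chain (S : Type*) (k : ℕ) : Type _ := (Fin k → S) →₀ ℤ

/-- `(x_1, …, x_{k+1}) ↦ (x_1, …, x_{i-1}, x_i ⋆ x_{i+1}, …, x_i ⋆ x_{k+1})`. -/
def faceOp {k : ℕ} (i : Fin (k + 1)) (x : Fin (k + 1) → S) : Fin k → S :=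
  fun j => if i.succAbove j < i then x (i.succAbove j) else m (x i) (x (i.succAbove j))

/-- `(x_1, …, x_{k+1}) ↦ (x_1, …, x_{i-1}, x_{i+1}, …, x_{k+1})`. -/
def faceZero {k : ℕ} (i : Fin (k + 1)) (x : Fin (k + 1) → S) : Fin k → S :=
  fun j => x (i.succAbove j)

/-- `∂^⋆ : C_{k+1}(S) → C_k(S)`; indices start at `0`, so the sign of the first face is `+`. -/
noncomputable def bdryOp (k : ℕ) : Chain S (k + 1) →ₗ[ℤ] Chain S k :=
  ∑ i : Fin (k + 1), (-1 : ℤ) ^ (i : ℕ) • Finsupp.lmapDomain ℤ ℤ (faceOp m i)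

/-- `∂^0 : C_{k+1}(S) → C_k(S)`. -/
noncomputable def bdryZero (S : Type*) (k : ℕ) : Chain S (k + 1) →ₗ[ℤ] Chain S k :=
  ∑ i : Fin (k + 1), (-1 : ℤ) ^ (i : ℕ) • Finsupp.lmapDomain ℤ ℤ (faceZero i)

/-- The rack differential `∂^⋆ - ∂^0 : C_{k+1}(S) → C_k(S)`. -/
noncomputable def bdry (k : ℕ) : Chain S (k + 1) →ₗ[ℤ] Chain S k :=
  bdryOp m k - bdryZero S k

/-- `C^k(S; G) = Hom(C_k(S), G)`. -/
abbrev Cochain (S G : Type*) [AddCommGroup G] (k : ℕ) : Type _ := Chain S k →ₗ[ℤ] G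

variable (G : Type*) [AddCommGroup G]

/-- The induced differential `C^k(S; G) → C^{k+1}(S; G)`, `φ ↦ φ ∘ ∂`. -/
noncomputable def cobdry (k : ℕ) : Cochain S G k →ₗ[ℤ] Cochain S G (k + 1) :=
  LinearMap.lcomp ℤ G (bdry m k)

/-- The `G`-valued rack `k`-cocycles. -/
noncomputable def cocycles (k : ℕ) : Submodule ℤ (Cochain S G k) :=
  LinearMap.ker (cobdry m G k)

/-- The `G`-valued rack `k`-coboundaries. -/
noncomputable def coboundaries : (k : ℕ) → Submodule ℤ (Cochain S G k)
  | 0 => ⊥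
  | k + 1 => LinearMap.range (cobdry m G k)

variable {G}

/-- The `2`-cochain defined by a map `S × S → G`, by linear extension. -/
noncomputable def ofMap (φ : S → S → G) : Cochain S G 2 :=
  Finsupp.lift G ℤ (Fin 2 → S) (fun v => φ (v 0) (v 1))

end RackComplex

/-!
A 2-cocycle is a map `φ` with `φ(x ⋆ y, x ⋆ z) + φ(x, z) = φ(x, y ⋆ z) + φ(y, z)`. Putting `z = 1`
expresses `φ(x, y ⋆ 1)` through values in rows further down the table, so `φ` is determined by the
`2 ^ n` values `φ(x, 1)` (`eq_zero_of_cocycle`). The coboundary of `θ`, which is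
`θ(x ⋆ y) - θ(y)`, takes the value `θ(x ⋆ 1) - θ(1)` at `(x, 1)`; as `x ↦ x ⋆ 1` is a cyclic
permutation, every cocycle is a constant plus a coboundary (`exists_eq_of_cocycle`).

The map `ψ_q` is the coboundary of `-f_q`, where `f_q` is the indicator function of the set of `y`
whose column contains `q`: columns satisfy `col(x ⋆ y) ⊆ col(y)`, since the rows of the table are
closed under composition. Hence everything rests on the `f_q`, `1 ≤ q ≤ 2 ^ n`, being a basis of the
functions on the table; `f_q` at `q = 2 ^ n` is constant, with coboundary zero. This is
Möbius inversion for the relation "`q` is in the column of `y`", that is, right divisibility,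
provided that it is a partial order (`rightDvdOrder`).

The remaining point is antisymmetry (`eq_of_table_eq_of_table_eq`). By induction on `n` through the
projection `A_{n+1} → A_n`, it is enough to see that no row of `A_{n+1}` except the last one fixes
an element `y ≤ 2 ^ n` (`table_ne_self`). The largest such `s < 2 ^ (n+1)` would be idempotent for
composition, which forces `s ⋆ s = 2 ^ (n+1)`; but `s < y ≤ 2 ^ n`, and squares in the first half
of the table are never the last element (`table_self_ne_top`).

The facts on Laver tables used on the way, in particular left self-distributivity, are proved from
the recursive definition by comparing the rows of `A_{n+1}` with those of `A_n`.
-/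

namespace LaverTable

/-! ### The Laver table as a function on the natural numbers -/

/-- The product `p ⋆ q` of the `n`th Laver table as a function on natural numbers. It is meant for
`1 ≤ p ≤ 2 ^ n` and for every `q ≥ 1`: the row of `p < 2 ^ n` is continued past `q = 2 ^ n` by the
same recursion (hence periodically), the row of `2 ^ n` by the identity. No reduction modulo `2 ^ n`
is then needed in the recursion rule `table_succ`. -/
def table (n p q : ℕ) : ℕ := (laverAux (2 ^ n) p (q - 1)).1

theorem table_one {n p : ℕ} (hp : p < 2 ^ n) : table n p 1 = p + 1 := by
  rw [table, laverAux, dif_pos hp]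
  rfl

theorem table_succ {n p q : ℕ} (hp : p < 2 ^ n) (hq : 1 ≤ q) :
    table n p (q + 1) = table n (table n p q) (p + 1) := by
  obtain ⟨k, rfl⟩ : ∃ k, q = k + 1 := ⟨q - 1, by omega⟩
  rw [table, laverAux, dif_pos hp]
  rfl

theorem table_top (n : ℕ) {q : ℕ} (hq : 1 ≤ q) : table n (2 ^ n) q = q := by
  have := (laverAux (2 ^ n) (2 ^ n) (q - 1)).2.2 le_rfl
  simp only [table]
  omega

theorem lt_table {n p : ℕ} (hp : p < 2 ^ n) (q : ℕ) : p < table n p q :=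
  ((laverAux (2 ^ n) p (q - 1)).2.1 hp).1

theorem table_le {n p : ℕ} (hp : p < 2 ^ n) (q : ℕ) : table n p q ≤ 2 ^ n :=
  ((laverAux (2 ^ n) p (q - 1)).2.1 hp).2

/-- Once a row reaches `2 ^ n`, it starts again. -/
theorem table_add {n p d : ℕ} (hp : p < 2 ^ n) (hd : 1 ≤ d) (h : table n p d = 2 ^ n) {x : ℕ}
    (hx : 1 ≤ x) : table n p (d + x) = table n p x := by
  induction x, hx using Nat.le_induction with
  | base => rw [table_succ hp hd, h, table_top n (by omega), table_one hp]
  | succ x hx ih => rw [← add_assoc, table_succ hp (by omega), ih, table_succ hp hx]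

theorem table_eq_top_of_dvd {n p d x : ℕ} (hp : p < 2 ^ n) (hd : 1 ≤ d) (h : table n p d = 2 ^ n)
    (hx : 1 ≤ x) (hdx : d ∣ x) : table n p x = 2 ^ n := by
  obtain ⟨k, rfl⟩ := hdx
  induction k with
  | zero => omega
  | succ k ih =>
    rcases Nat.eq_zero_or_pos k with rfl | hk
    · simpa using h
    · rw [mul_add, mul_one, add_comm, table_add hp hd h (Nat.mul_pos hd hk)]
      exact ih (Nat.mul_pos hd hk)

/-- The period `d` of a row. It is at most `2 ^ n - p` because the row of `p` increases, starting
from `p + 1`, until it reaches `2 ^ n`. -/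
theorem exists_period {n p : ℕ} (hp : p < 2 ^ n) :
    ∃ d, 1 ≤ d ∧ d + p ≤ 2 ^ n ∧ table n p d = 2 ^ n ∧
      ∀ x, 1 ≤ x → table n p x = 2 ^ n → d ∣ x := by
  have key : ∀ x, 1 ≤ x → (∀ y, 1 ≤ y → y < x → table n p y ≠ 2 ^ n) → p + x ≤ table n p x := by
    intro x hx
    induction x, hx using Nat.le_induction with
    | base => intro _; rw [table_one hp]
    | succ x hx ih =>
      intro h
      have h1 := ih fun y hy hyx => h y hy (by omega)
      have h2 := h x hx (by omega)
      have h3 := table_le hp x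
      rw [table_succ hp hx]
      have := lt_table (lt_of_le_of_ne h3 h2) (p + 1)
      omega
  have hex : ∃ d, 1 ≤ d ∧ table n p d = 2 ^ n := by
    by_contra! hne
    have := key (2 ^ n + 1) (by omega) fun y hy _ => hne y hy
    have := table_le hp (2 ^ n + 1)
    omega
  classical
  refine ⟨Nat.find hex, (Nat.find_spec hex).1, ?_, (Nat.find_spec hex).2, ?_⟩
  · have := key _ (Nat.find_spec hex).1 fun y hy hyd h => Nat.find_min hex hyd ⟨hy, h⟩
    have := table_le hp (Nat.find hex)
    omega
  · obtain ⟨hd, hdt⟩ := Nat.find_spec hex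
    have hmin : ∀ m, m < Nat.find hex → ¬ (1 ≤ m ∧ table n p m = 2 ^ n) :=
      fun m hm => Nat.find_min hex hm
    generalize Nat.find hex = d at *
    intro x
    induction x using Nat.strong_induction_on with
    | _ x ih =>
      intro hx hxt
      rcases lt_trichotomy x d with h | h | h
      · exact absurd ⟨hx, hxt⟩ (hmin x h)
      · rw [h]
      · obtain ⟨y, rfl⟩ := Nat.exists_eq_add_of_lt h
        rw [add_assoc, table_add hp hd hdt (by omega)] at hxt
        rw [add_assoc]
        exact dvd_add dvd_rfl (ih (y + 1) (by omega) (by omega) hxt)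

/-! ### From the `n`th table to the next one -/

/-- Every row of the `n`th table takes the value `2 ^ n` at `2 ^ n`. -/
def RowsEndAtTop (n : ℕ) : Prop := ∀ p, 1 ≤ p → p < 2 ^ n → table n p (2 ^ n) = 2 ^ n

/-- The lower right part of the table `A_{n+1}` is a shifted copy of `A_n`. -/
theorem RowsEndAtTop.table_succ_add {n : ℕ} (h : RowsEndAtTop n) {p : ℕ} (hp : 1 ≤ p)
    (hpn : p < 2 ^ n) {q : ℕ} (hq : 1 ≤ q) :
    table (n + 1) (2 ^ n + p) q = 2 ^ n + table n p q := by
  have h2 : 2 ^ (n + 1) = 2 ^ n + 2 ^ n := by ring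
  induction hk : 2 ^ n - p using Nat.strong_induction_on generalizing p q with
  | _ k ih =>
    have hp' : 2 ^ n + p < 2 ^ (n + 1) := by omega
    induction q, hq using Nat.le_induction with
    | base => rw [table_one hp', table_one hpn, add_assoc]
    | succ q hq ihq =>
      rw [table_succ hp' hq, ihq, table_succ hpn hq]
      have h3 := lt_table hpn q
      rcases (table_le hpn q).lt_or_eq with h4 | h4
      · rw [ih _ (by omega) (by omega) h4 (by omega) rfl, add_assoc,
          table_add h4 (by omega) (h _ (by omega) h4) (by omega)]
      · rw [h4, ← h2, table_top _ (by omega), table_top _ (by omega), add_assoc]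

theorem RowsEndAtTop.table_succ_pow {n : ℕ} (h : RowsEndAtTop n) {q : ℕ} (hq : 1 ≤ q)
    (hqn : q ≤ 2 ^ n) : table (n + 1) (2 ^ n) q = 2 ^ n + q := by
  have h2 : 2 ^ (n + 1) = 2 ^ n + 2 ^ n := by ring
  have hp' : 2 ^ n < 2 ^ (n + 1) := by omega
  induction q, hq using Nat.le_induction with
  | base => rw [table_one hp']
  | succ q hq ih =>
    rw [table_succ hp' hq, ih (by omega), h.table_succ_add hq (by omega) (by omega),
      table_add (by omega) (by omega) (h q hq (by omega)) le_rfl, table_one (by omega)]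

/-- Modulo `2 ^ n`, the first `2 ^ n - 1` rows of `A_{n+1}` are those of `A_n`. -/
theorem RowsEndAtTop.table_succ_eq_or {n : ℕ} (h : RowsEndAtTop n) {p : ℕ} (hp : 1 ≤ p)
    (hpn : p < 2 ^ n) {q : ℕ} (hq : 1 ≤ q) :
    table (n + 1) p q = table n p q ∨ table (n + 1) p q = 2 ^ n + table n p q := by
  have h2 : 2 ^ (n + 1) = 2 ^ n + 2 ^ n := by ring
  induction hk : 2 ^ n - p using Nat.strong_induction_on generalizing p q with
  | _ k ih =>
    have hp' : p < 2 ^ (n + 1) := by omega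
    induction q, hq using Nat.le_induction with
    | base => rw [table_one hp', table_one hpn]; exact Or.inl rfl
    | succ q hq ihq =>
      rw [table_succ hp' hq, table_succ hpn hq]
      have h3 := lt_table hpn q
      rcases (table_le hpn q).lt_or_eq with h4 | h4 <;> rcases ihq with h5 | h5 <;> rw [h5]
      · exact ih _ (by omega) (by omega) h4 (by omega) rfl
      · exact Or.inr (h.table_succ_add (by omega) h4 (by omega))
      · rw [h4, h.table_succ_pow (by omega) hpn, table_top _ (by omega)]
        exact Or.inr rfl
      · rw [h4, ← h2, table_top _ (by omega), table_top _ (by omega)]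
        exact Or.inl rfl

/-- From one table to the next, the period of a row is multiplied by `1` or `2`. -/
theorem RowsEndAtTop.table_two_mul {n : ℕ} (h : RowsEndAtTop n) {p d : ℕ} (hp : 1 ≤ p)
    (hpn : p < 2 ^ n) (hd : 1 ≤ d) (hdt : table n p d = 2 ^ n)
    (hdvd : ∀ x, 1 ≤ x → table n p x = 2 ^ n → d ∣ x) :
    table (n + 1) p (2 * d) = 2 ^ (n + 1) := by
  have h2 : 2 ^ (n + 1) = 2 ^ n + 2 ^ n := by ring
  have hp' : p < 2 ^ (n + 1) := by omega
  have hmod := fun {x : ℕ} => h.table_succ_eq_or hp hpn (q := x)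
  rcases hmod hd with h3 | h3
  · -- The row of `p` passes `2 ^ n` at `d`, and does not come back below before it ends at `2 * d`.
    have key : ∀ x, 1 ≤ x → x ≤ d → 2 ^ n < table (n + 1) p (d + x) := by
      intro x hx
      induction x, hx using Nat.le_induction with
      | base =>
        intro _
        rw [table_succ hp' hd, h3, hdt, h.table_succ_pow (by omega) (by omega)]
        omega
      | succ x hx ih =>
        intro hxd
        have h4 := ih (by omega)
        have h5 : table (n + 1) p (d + x) ≠ 2 ^ (n + 1) := by
          intro h6
          have h7 : table n p (d + x) = 2 ^ n := by
            have := table_le hpn (d + x)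
            rcases hmod (x := d + x) (by omega) with h7 | h7 <;> omega
          rw [table_add hpn hd hdt hx] at h7
          have := Nat.le_of_dvd hx (hdvd x hx h7)
          omega
        rw [← add_assoc, table_succ hp' (by omega)]
        have := lt_table (lt_of_le_of_ne (table_le hp' (d + x)) h5) (p + 1)
        omega
    have h4 := key d hd le_rfl
    have h5 : table n p (2 * d) = 2 ^ n :=
      table_eq_top_of_dvd hpn hd hdt (by omega) (Dvd.intro_left 2 rfl)
    rw [← two_mul] at h4
    rcases hmod (x := 2 * d) (by omega) with h6 | h6 <;> omega
  · exact table_eq_top_of_dvd hp' hd (by omega) (by omega) (Dvd.intro_left 2 rfl)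

/-- The period of the row of `p` in `A_n` is a power of `2` and at most `2 ^ n - p`. If this is less
than `2 ^ k`, the period in `A_{n+1}` divides `2 ^ k`. -/
theorem RowsEndAtTop.table_succ_pow_eq_top {n : ℕ} (h : RowsEndAtTop n) {p : ℕ} (hp : 1 ≤ p)
    (hpn : p < 2 ^ n) {k : ℕ} (hk : 2 ^ n < 2 ^ k + p) :
    table (n + 1) p (2 ^ k) = 2 ^ (n + 1) := by
  obtain ⟨d, hd, hdp, hdt, hdvd⟩ := exists_period hpn
  obtain ⟨o, -, rfl⟩ := (Nat.dvd_prime_pow Nat.prime_two).1 (hdvd _ Nat.one_le_two_pow (h p hp hpn))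
  have ho : o < k := (Nat.pow_lt_pow_iff_right (a := 2) (by norm_num)).1 (by omega)
  refine table_eq_top_of_dvd (d := 2 * 2 ^ o) (by rw [pow_succ]; omega) (by omega)
    (h.table_two_mul hp hpn hd hdt hdvd) Nat.one_le_two_pow ?_
  rw [← pow_succ']
  exact pow_dvd_pow 2 ho

theorem rowsEndAtTop (n : ℕ) : RowsEndAtTop n := by
  induction n with
  | zero => intro p hp hpn; simp at hpn; omega
  | succ n h =>
    have h2 : 2 ^ (n + 1) = 2 ^ n + 2 ^ n := by ring
    intro p hp hpn
    have h3 : table (n + 1) p (2 ^ n) = 2 ^ (n + 1) := by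
      rcases lt_trichotomy p (2 ^ n) with h1 | rfl | h1
      · exact h.table_succ_pow_eq_top hp h1 (by omega)
      · rw [h.table_succ_pow hp le_rfl, h2]
      · obtain ⟨r, rfl⟩ := Nat.exists_eq_add_of_lt h1
        rw [add_assoc, h.table_succ_add (by omega) (by omega) Nat.one_le_two_pow,
          h _ (by omega) (by omega), h2]
    exact table_eq_top_of_dvd hpn Nat.one_le_two_pow h3 Nat.one_le_two_pow
      (pow_dvd_pow 2 (Nat.le_succ n))

/-! ### Self-distributivity and composition -/

/-- Left self-distributivity. The induction is downwards on `a`, then downwards on `b`, then upwards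
on `c`. -/
theorem table_table {n a b c : ℕ} (ha : 1 ≤ a) (han : a ≤ 2 ^ n) (hb : 1 ≤ b) (hbn : b ≤ 2 ^ n)
    (hc : 1 ≤ c) :
    table n a (table n b c) = table n (table n a b) (table n a c) := by
  induction hk : 2 ^ n - a using Nat.strong_induction_on generalizing a b c with
  | _ k iha =>
    have hpos : ∀ {p q : ℕ}, p ≤ 2 ^ n → 1 ≤ q → 1 ≤ table n p q := by
      intro p q hp hq
      rcases hp.lt_or_eq with h | rfl
      · have := lt_table h q
        omega
      · rwa [table_top _ hq]
    rcases han.lt_or_eq with han' | rfl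
    swap
    · rw [table_top _ (hpos hbn hc), table_top _ hb, table_top _ hc]
    induction hl : 2 ^ n - b using Nat.strong_induction_on generalizing b c with
    | _ l ihb =>
      rcases hbn.lt_or_eq with hbn' | rfl
      swap
      · rw [table_top _ hc, rowsEndAtTop n a ha han', table_top _ (hpos han hc)]
      induction c, hc using Nat.le_induction with
      | base => rw [table_one hbn', table_one han', table_succ han' hb]
      | succ c hc ihc =>
        have h1 := lt_table hbn' c
        have h2 := lt_table han' b
        rw [table_succ hbn' hc, ihb _ (by omega) (by omega) (table_le hbn' c) (by omega) rfl, ihc,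
          table_succ han' hb, table_succ han' hc]
        exact (iha (2 ^ n - table n a b) (by omega) (by omega) (table_le han' b) (hpos han hc)
          (table_le han' c) (by omega) rfl).symm

/-- The rows of a Laver table are closed under composition: the composite of the rows of `p` and `q`
is the row of `p ⋆ (q + 1) - 1`. -/
theorem table_table_eq_of_table_succ {n p q r : ℕ} (hp : 1 ≤ p) (hpn : p ≤ 2 ^ n) (hq : 1 ≤ q)
    (hqn : q < 2 ^ n) (hrn : r < 2 ^ n) (h : table n p (q + 1) = r + 1) {x : ℕ} (hx : 1 ≤ x) :
    table n p (table n q x) = table n r x := by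
  induction x, hx using Nat.le_induction with
  | base => rw [table_one hqn, h, table_one hrn]
  | succ x hx ih =>
    have := lt_table hqn x
    rw [table_succ hqn hx, table_table hp hpn (by omega) (table_le hqn x) (by omega), ih, h,
      table_succ hrn hx]

/-! ### Squares and fixed points -/

/-- In the first quarter, the row of `2 ^ m` in `A_{m+2}` is a translation. -/
theorem table_pow_of_le {m q : ℕ} (hq : 1 ≤ q) (hqm : q ≤ 2 ^ m) :
    table (m + 2) (2 ^ m) q = 2 ^ m + q := by
  have h2 : 2 ^ (m + 1) = 2 ^ m + 2 ^ m := by ring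
  have h3 : 2 ^ (m + 2) = 2 ^ (m + 1) + 2 ^ (m + 1) := by ring
  have hlt : 2 ^ m < 2 ^ (m + 2) := by omega
  induction q, hq using Nat.le_induction with
  | base => rw [table_one hlt]
  | succ q hq ih =>
    rw [table_succ hlt hq, ih (by omega), table_add (by omega) Nat.one_le_two_pow
      ((rowsEndAtTop (m + 1)).table_succ_pow_eq_top (by omega) (by omega) (by omega))
      le_rfl, table_one (by omega), add_assoc]

theorem dvd_of_table_pow_eq_top {m x : ℕ} (hx : 1 ≤ x)
    (h : table (m + 2) (2 ^ m) x = 2 ^ (m + 2)) : 2 ^ (m + 1) ∣ x := by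
  have h2 : 2 ^ (m + 1) = 2 ^ m + 2 ^ m := by ring
  have h3 : 2 ^ (m + 2) = 2 ^ (m + 1) + 2 ^ (m + 1) := by ring
  have hlt : 2 ^ m < 2 ^ (m + 2) := Nat.pow_lt_pow_right (by norm_num) (by omega)
  obtain ⟨d, hd, -, hdt, hdvd⟩ := exists_period hlt
  obtain ⟨o, -, rfl⟩ := (Nat.dvd_prime_pow Nat.prime_two).1
    (hdvd _ Nat.one_le_two_pow (rowsEndAtTop (m + 2) _ Nat.one_le_two_pow hlt))
  refine (pow_dvd_pow 2 ?_).trans (hdvd x hx h)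
  by_contra! ho
  have h4 : 2 ^ o ≤ 2 ^ m := Nat.pow_le_pow_right (by norm_num) (by omega)
  rw [table_pow_of_le hd h4] at hdt
  omega

/-- No square in the first half of the rows is the last element. If `s = 2 ^ m + t` with
`1 ≤ t < 2 ^ m`, then the row of `s` in `A_{m+2}` is the composite of those of `2 ^ m` and `t`, and
`s ⋆ s` can only be `2 ^ (m+2)` if `t ⋆ t` is `2 ^ (m+1)` in `A_{m+1}`. -/
theorem table_self_ne_top {m s : ℕ} (hs : 1 ≤ s) (hsm : s < 2 ^ m) :
    table (m + 1) s s ≠ 2 ^ (m + 1) := by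
  induction m generalizing s with
  | zero => simp at hsm; omega
  | succ m ih =>
    have h2 : 2 ^ (m + 1) = 2 ^ m + 2 ^ m := by ring
    have h3 : 2 ^ (m + 2) = 2 ^ (m + 1) + 2 ^ (m + 1) := by ring
    have hR := rowsEndAtTop (m + 1)
    intro h
    change table (m + 2) s s = 2 ^ (m + 2) at h
    rcases lt_trichotomy s (2 ^ m) with h1 | rfl | h1
    · have := table_le hsm s
      refine ih hs h1 ?_
      rcases hR.table_succ_eq_or hs hsm hs with h4 | h4 <;>
        change table (m + 2) s s = _ at h4 <;> omega
    · rw [table_pow_of_le hs le_rfl] at h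
      omega
    · obtain ⟨t, rfl⟩ : ∃ t, s = 2 ^ m + t := ⟨s - 2 ^ m, by omega⟩
      have ht : 1 ≤ t := by omega
      have htm : t < 2 ^ (m + 1) := by omega
      rw [← table_table_eq_of_table_succ (p := 2 ^ m) (q := t) (r := 2 ^ m + t)
        Nat.one_le_two_pow (by omega) ht (by omega) (by omega) (table_pow_of_le (by omega) (by omega)) hs] at h
      have h4 := lt_table (n := m + 2) (p := t) (by omega) (2 ^ m + t)
      obtain ⟨k, hk⟩ := dvd_of_table_pow_eq_top (by omega) h
      have h5 : table (m + 1) t (2 ^ m + t) = 2 ^ (m + 1) := by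
        have h6 := table_le htm (2 ^ m + t)
        have h7 := lt_table htm (2 ^ m + t)
        have h8 : 2 ^ (m + 1) ∣ table (m + 1) t (2 ^ m + t) := by
          rcases hR.table_succ_eq_or ht htm hs with h8 | h8 <;> change table (m + 2) t _ = _ at h8
          · exact ⟨k, by rw [← h8, hk]⟩
          · rw [h8] at hk
            exact (Nat.dvd_add_right dvd_rfl).1 ⟨k, hk⟩
        exact le_antisymm h6 (Nat.le_of_dvd (by omega) h8)
      rw [table_add htm Nat.one_le_two_pow
        ((rowsEndAtTop m).table_succ_pow_eq_top ht (by omega) (by omega)) ht] at h5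
      exact ih ht (by omega) h5

/-- An element of the first half is fixed by the last row only: the largest other row fixing it would
be idempotent under composition, so that its index `s` would satisfy `s ⋆ s = 2 ^ (m+1)`. -/
theorem table_ne_self {m s y : ℕ} (hs : 1 ≤ s) (hsm : s < 2 ^ (m + 1)) (hy : y ≤ 2 ^ m) :
    table (m + 1) s y ≠ y := by
  induction hk : 2 ^ (m + 1) - s using Nat.strong_induction_on generalizing s with
  | _ k ih =>
    intro h
    have h1 := lt_table hsm y
    have h2 := lt_table hsm (s + 1)
    have h3 := table_le hsm (s + 1)
    obtain ⟨r, hr⟩ : ∃ r, table (m + 1) s (s + 1) = r + 1 := Nat.exists_eq_add_one.2 (by omega)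
    have h4 : table (m + 1) r y = y := by
      rw [← table_table_eq_of_table_succ (r := r) hs hsm.le hs hsm (by omega) hr (by omega), h, h]
    rcases (show s ≤ r by omega).lt_or_eq with h5 | rfl
    · exact ih (2 ^ (m + 1) - r) (by omega) (by omega) (by omega) rfl h4
    · refine table_self_ne_top hs (by omega) ((table_le hsm s).eq_of_not_lt fun h6 => ?_)
      rw [table_succ hsm hs] at hr
      have := lt_table h6 (s + 1)
      have := lt_table hsm s
      omega

/-! ### The right divisibility order -/

/-- Reduction modulo `2 ^ n` from `{1, …, 2 ^ (n+1)}` to `{1, …, 2 ^ n}`. -/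
def reduce (n x : ℕ) : ℕ := if x ≤ 2 ^ n then x else x - 2 ^ n

theorem reduce_of_le {n x : ℕ} (h : x ≤ 2 ^ n) : reduce n x = x := if_pos h

theorem reduce_add {n x : ℕ} (h : 1 ≤ x) : reduce n (2 ^ n + x) = x := by
  rw [reduce, if_neg (by omega), Nat.add_sub_cancel_left]

theorem reduce_mem {n x : ℕ} (h : 1 ≤ x) (hx : x ≤ 2 ^ (n + 1)) :
    1 ≤ reduce n x ∧ reduce n x ≤ 2 ^ n := by
  rw [pow_succ] at hx
  unfold reduce
  split_ifs <;> omega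

/-- Reduction modulo `2 ^ n` is a homomorphism from `A_{n+1}` to `A_n`. -/
theorem reduce_table {n p q : ℕ} (hp : 1 ≤ p) (hpn : p ≤ 2 ^ (n + 1)) (hq : 1 ≤ q)
    (hqn : q ≤ 2 ^ (n + 1)) :
    reduce n (table (n + 1) p q) = table n (reduce n p) (reduce n q) := by
  have h2 : 2 ^ (n + 1) = 2 ^ n + 2 ^ n := by ring
  have hR := rowsEndAtTop n
  have hcol : ∀ {r : ℕ}, 1 ≤ r → r < 2 ^ n → table n r (reduce n q) = table n r q := by
    intro r hr hrn
    rcases le_or_gt q (2 ^ n) with h | h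
    · rw [reduce_of_le h]
    · obtain ⟨t, rfl⟩ : ∃ t, q = 2 ^ n + t := ⟨q - 2 ^ n, by omega⟩
      rw [reduce_add (by omega), table_add hrn Nat.one_le_two_pow (hR r hr hrn) (by omega)]
  rcases lt_trichotomy p (2 ^ n) with h | rfl | h
  · rw [reduce_of_le h.le, hcol hp h]
    have h3 := lt_table h q
    rcases hR.table_succ_eq_or hp h hq with h4 | h4 <;> rw [h4]
    · exact reduce_of_le (table_le h q)
    · exact reduce_add (by omega)
  · rw [reduce_of_le le_rfl, table_top _ (reduce_mem hq hqn).1]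
    rcases le_or_gt q (2 ^ n) with h | h
    · rw [hR.table_succ_pow hq h, reduce_add hq, reduce_of_le h]
    · obtain ⟨t, rfl⟩ : ∃ t, q = 2 ^ n + t := ⟨q - 2 ^ n, by omega⟩
      rw [table_add (by omega) hp (by rw [hR.table_succ_pow hp le_rfl, h2]) (by omega),
        hR.table_succ_pow (by omega) (by omega)]
  · rcases hpn.lt_or_eq with hpn' | rfl
    · obtain ⟨t, rfl⟩ : ∃ t, p = 2 ^ n + t := ⟨p - 2 ^ n, by omega⟩
      have ht : t < 2 ^ n := by omega
      have h3 := lt_table ht q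
      rw [hR.table_succ_add (by omega) ht hq, reduce_add (by omega), reduce_add (by omega),
        hcol (by omega) ht]
    · rw [table_top _ hq, h2, reduce_add Nat.one_le_two_pow, table_top _ (reduce_mem hq hqn).1]

/-- Two elements of a Laver table that divide each other on the right are equal. By induction they
agree modulo `2 ^ n`; if they differ, the smaller one, `y`, lies in the first half of the table and
is fixed by a composite of two rows, against `table_ne_self`. -/
theorem eq_of_table_eq_of_table_eq {n p r y z : ℕ} (hp : 1 ≤ p) (hpn : p ≤ 2 ^ n) (hr : 1 ≤ r)
    (hrn : r ≤ 2 ^ n) (hy : 1 ≤ y) (hyn : y ≤ 2 ^ n) (hz : 1 ≤ z) (hzn : z ≤ 2 ^ n)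
    (hpy : table n p y = z) (hrz : table n r z = y) : y = z := by
  induction n generalizing p r y z with
  | zero => simp at hyn hzn; omega
  | succ n ih =>
    have hred : reduce n y = reduce n z := by
      refine ih (reduce_mem hp hpn).1 (reduce_mem hp hpn).2 (reduce_mem hr hrn).1
        (reduce_mem hr hrn).2 (reduce_mem hy hyn).1 (reduce_mem hy hyn).2 (reduce_mem hz hzn).1
        (reduce_mem hz hzn).2 ?_ ?_
      · rw [← reduce_table hp hpn hy hyn, hpy]
      · rw [← reduce_table hr hrn hz hzn, hrz]
    have key : ∀ {p r y z : ℕ}, 1 ≤ p → p ≤ 2 ^ (n + 1) → 1 ≤ r → r ≤ 2 ^ (n + 1) → 1 ≤ y →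
        1 ≤ z → table (n + 1) p y = z → table (n + 1) r z = y → y ≤ 2 ^ n → y = z := by
      intro p r y z hp hpn hr hrn hy hz hpy hrz hyn
      rcases hpn.lt_or_eq with hpn' | rfl
      · rcases hrn.lt_or_eq with hrn' | rfl
        · have h1 := lt_table hrn' (p + 1)
          have h2 := table_le hrn' (p + 1)
          obtain ⟨s, hs⟩ : ∃ s, table (n + 1) r (p + 1) = s + 1 := Nat.exists_eq_add_one.2 (by omega)
          refine absurd ?_ (table_ne_self (m := n) (s := s) (by omega) (by omega) hyn)
          rw [← table_table_eq_of_table_succ (r := s) hr hrn hp hpn' (by omega) hs hy, hpy, hrz]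
        · rw [← hrz, table_top _ hz]
      · rw [← hpy, table_top _ hy]
    rcases le_or_gt y (2 ^ n) with hy2 | hy2
    · exact key hp hpn hr hrn hy hz hpy hrz hy2
    rcases le_or_gt z (2 ^ n) with hz2 | hz2
    · exact (key hr hrn hp hpn hz hy hrz hpy hz2).symm
    · simp only [reduce, if_neg hy2.not_ge, if_neg hz2.not_ge] at hred
      omega

end LaverTable

/-! ### Sums over up-sets -/

/-- On a finite partial order, every function is a sum over principal up-sets. -/
theorem exists_sum_ite_le_eq {α : Type*} [Fintype α] [PartialOrder α] [DecidableLE α]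
    (f : α → ℤ) : ∃ a : α → ℤ, ∀ y, ∑ q, (if y ≤ q then a q else 0) = f y := by
  classical
  let a : α → ℤ := (wellFounded_gt (α := α)).fix fun y rec =>
    f y - ∑ q, if h : y < q then rec q h else 0
  refine ⟨a, fun y => ?_⟩
  have h : a y = f y - ∑ q, if y < q then a q else 0 := by
    rw [show a y = _ from WellFounded.fix_eq _ _ _]
    simp only [dite_eq_ite]
    rfl
  have h2 : ∀ q, (if y ≤ q then a q else 0) =
      (if y = q then a q else 0) + if y < q then a q else 0 := by
    intro q
    rcases eq_or_ne y q with rfl | hq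
    · simp
    · simp [hq, lt_iff_le_and_ne]
  simp only [h2, Finset.sum_add_distrib, Finset.sum_ite_eq, Finset.mem_univ, if_true, h]
  ring

theorem eq_zero_of_sum_ite_le_eq_zero {α : Type*} [Fintype α] [PartialOrder α] [DecidableLE α]
    {a : α → ℤ} (h : ∀ y, ∑ q, (if y ≤ q then a q else 0) = 0) : a = 0 := by
  funext y
  induction y using (wellFounded_gt (α := α)).induction with
  | _ y ih =>
    rw [Pi.zero_apply, ← h y, Finset.sum_eq_single y]
    · simp
    · intro q _ hq
      split_ifs with h1
      · exact ih q (lt_of_le_of_ne h1 hq.symm)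
      · rfl
    · simp

namespace RackComplex

/-! ### Low-dimensional rack cochains -/

section LowDimension

variable {S G : Type*} [AddCommGroup G] (m : S → S → S)

@[simp]
theorem ofMap_single (φ : S → S → G) (v : Fin 2 → S) :
    ofMap φ (Finsupp.single v 1) = φ (v 0) (v 1) := by
  simp [ofMap]

theorem ofMap_eval (φ : Cochain S G 2) :
    ofMap (fun x y => φ (Finsupp.single ![x, y] 1)) = φ := by
  refine Finsupp.lhom_ext' fun v => LinearMap.ext_ring ?_
  rw [LinearMap.comp_apply, LinearMap.comp_apply, Finsupp.lsingle_apply, ofMap_single]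
  congr 2
  ext i
  fin_cases i <;> rfl

theorem cobdry_one_single (θ : Cochain S G 1) (v : Fin 2 → S) :
    cobdry m G 1 θ (Finsupp.single v 1) =
      θ (Finsupp.single ![m (v 0) (v 1)] 1) - θ (Finsupp.single ![v 1] 1) := by
  have h1 : faceOp m (0 : Fin 2) v = ![m (v 0) (v 1)] := by
    ext i; fin_cases i; rfl
  have h2 : faceOp m (1 : Fin 2) v = ![v 0] := by
    ext i; fin_cases i; rfl
  have h3 : faceZero (0 : Fin 2) v = ![v 1] := by
    ext i; fin_cases i; rfl
  have h4 : faceZero (1 : Fin 2) v = ![v 0] := by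
    ext i; fin_cases i; rfl
  simp [cobdry, bdry, bdryOp, bdryZero, Fin.sum_univ_two, Finsupp.mapDomain_single, h1, h2, h3, h4]

theorem cobdry_two_single (φ : Cochain S G 2) (v : Fin 3 → S) :
    cobdry m G 2 φ (Finsupp.single v 1) =
      φ (Finsupp.single ![m (v 0) (v 1), m (v 0) (v 2)] 1) - φ (Finsupp.single ![v 1, v 2] 1) -
      (φ (Finsupp.single ![v 0, m (v 1) (v 2)] 1) - φ (Finsupp.single ![v 0, v 2] 1)) := by
  have h1 : faceOp m (0 : Fin 3) v = ![m (v 0) (v 1), m (v 0) (v 2)] := by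
    ext i; fin_cases i <;> rfl
  have h2 : faceOp m (1 : Fin 3) v = ![v 0, m (v 1) (v 2)] := by
    ext i; fin_cases i <;> rfl
  have h3 : faceOp m (2 : Fin 3) v = ![v 0, v 1] := by
    ext i; fin_cases i <;> rfl
  have h4 : faceZero (0 : Fin 3) v = ![v 1, v 2] := by
    ext i; fin_cases i <;> rfl
  have h5 : faceZero (1 : Fin 3) v = ![v 0, v 2] := by
    ext i; fin_cases i <;> rfl
  have h6 : faceZero (2 : Fin 3) v = ![v 0, v 1] := by
    ext i; fin_cases i <;> rfl
  simp [cobdry, bdry, bdryOp, bdryZero, Fin.sum_univ_three, Finsupp.mapDomain_single,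
    h1, h2, h3, h4, h5, h6]
  abel

theorem ofMap_mem_cocycles_iff (φ : S → S → G) :
    ofMap φ ∈ cocycles m G 2 ↔
      ∀ x y z, φ (m x y) (m x z) + φ x z = φ x (m y z) + φ y z := by
  rw [cocycles, LinearMap.mem_ker]
  constructor
  · intro h x y z
    have := LinearMap.congr_fun h (Finsupp.single ![x, y, z] 1)
    rw [cobdry_two_single] at this
    simp only [ofMap_single, LinearMap.zero_apply] at this
    rw [← sub_eq_zero, ← this]
    simp
    abel
  · intro h
    refine Finsupp.lhom_ext' fun v => LinearMap.ext_ring ?_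
    rw [LinearMap.comp_apply, Finsupp.lsingle_apply, cobdry_two_single]
    simp only [ofMap_single, LinearMap.comp_apply, LinearMap.zero_apply]
    have := h (v 0) (v 1) (v 2)
    rw [← sub_eq_zero] at this
    rw [← this]
    simp
    abel

theorem ofMap_sub_mem_coboundaries (θ : S → G) :
    ofMap (fun x y => θ (m x y) - θ y) ∈ coboundaries m G 2 := by
  refine ⟨Finsupp.lift G ℤ (Fin 1 → S) fun v => θ (v 0), ?_⟩
  refine Finsupp.lhom_ext' fun v => LinearMap.ext_ring ?_
  rw [LinearMap.comp_apply, LinearMap.comp_apply, Finsupp.lsingle_apply, cobdry_one_single]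
  simp

end LowDimension

end RackComplex

namespace LaverTable

/-! ### Cocycles of Laver tables -/

variable {n : ℕ}

theorem op_op (x y z : LaverTable n) : op x (op y z) = op (op x y) (op x z) :=
  Subtype.ext (table_table x.2.1 x.2.2 y.2.1 y.2.2 z.2.1)

/-- The element `2 ^ n` of `A_n`. -/
def last (n : ℕ) : LaverTable n := ⟨2 ^ n, Nat.one_le_two_pow, le_rfl⟩

theorem last_op (x : LaverTable n) : op (last n) x = x := op_of_last _ x rfl

/-- The map `x ↦ x ⋆ 1` is surjective. -/
theorem exists_op_one_eq (y : LaverTable n) : ∃ x, op x (one n) = y := by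
  rcases eq_or_ne y.1 1 with h | h
  · exact ⟨last n, (last_op _).trans (Subtype.ext h.symm)⟩
  · have h1 := y.2.1
    have h2 := y.2.2
    refine ⟨⟨y.1 - 1, by omega, by omega⟩, Subtype.ext ?_⟩
    rw [op_one, if_pos (by simp only; omega)]
    simp only
    omega

/-- Right divisors compose: `p ⋆ (x ⋆ y)` is a left multiple of `y`. -/
theorem inColumn_of_inColumn_op {q : ℕ} {x y : LaverTable n} (h : InColumn q (op x y)) :
    InColumn q y := by
  obtain ⟨p, rfl⟩ := h
  by_cases hp : p.1 < 2 ^ n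
  · by_cases hx : x.1 < 2 ^ n
    · have h1 := lt_table hp (x.1 + 1)
      have h2 := table_le hp (x.1 + 1)
      obtain ⟨r, hr⟩ := Nat.exists_eq_add_one.2 (show 0 < table n p.1 (x.1 + 1) by omega)
      have hp1 := p.2.1
      refine ⟨⟨r, by omega, by omega⟩, ?_⟩
      exact (table_table_eq_of_table_succ hp1 p.2.2 x.2.1 hx (by omega) hr y.2.1).symm
    · rw [op_of_last x y (le_antisymm x.2.2 (not_lt.1 hx))]
      exact ⟨p, rfl⟩
  · rw [op_of_last p _ (le_antisymm p.2.2 (not_lt.1 hp))]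
    exact ⟨x, rfl⟩

theorem inColumn_self (y : LaverTable n) : InColumn y.1 y := ⟨last n, by rw [last_op]⟩

theorem inColumn_one {q : ℕ} (hq : 1 ≤ q) (hqn : q ≤ 2 ^ n) : InColumn q (one n) := by
  obtain ⟨x, hx⟩ := exists_op_one_eq (⟨q, hq, hqn⟩ : LaverTable n)
  exact ⟨x, by rw [hx]⟩

theorem inColumn_last_iff {q : ℕ} : InColumn q (last n) ↔ q = 2 ^ n := by
  constructor
  · rintro ⟨p, rfl⟩
    by_cases hp : p.1 < 2 ^ n
    · exact rowsEndAtTop n p.1 p.2.1 hp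
    · rw [op_of_last p _ (le_antisymm p.2.2 (not_lt.1 hp))]
      rfl
  · rintro rfl
    exact inColumn_self (last n)

theorem inColumn_pow (y : LaverTable n) : InColumn (2 ^ n) y := by
  by_cases hy : y.1 < 2 ^ n
  · -- The element before the last sends everything to the last one.
    have h1 := y.2.1
    let p : LaverTable n := ⟨2 ^ n - 1, by omega, by omega⟩
    have hp : p.1 < 2 ^ n := by simp only [p]; omega
    refine ⟨p, ?_⟩
    have h2 := lt_op p y hp
    have h3 := (op p y).2.2
    simp only [p] at *
    omega
  · rw [← le_antisymm y.2.2 (not_lt.1 hy)]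
    exact inColumn_self y

/-- Right divisibility in the Laver table: `y ≤ q` if `q` appears in the column of `y`. -/
abbrev rightDvdOrder (n : ℕ) : PartialOrder (LaverTable n) where
  le y q := InColumn q.1 y
  lt y q := InColumn q.1 y ∧ ¬ InColumn y.1 q
  lt_iff_le_not_ge _ _ := Iff.rfl
  le_refl := inColumn_self
  le_trans a b c hab hbc := by
    obtain ⟨x, hx⟩ := hab
    rw [← Subtype.ext hx] at hbc
    exact inColumn_of_inColumn_op hbc
  le_antisymm a b hab hba := by
    obtain ⟨p, hp⟩ := hab
    obtain ⟨r, hr⟩ := hba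
    exact Subtype.ext (eq_of_table_eq_of_table_eq p.2.1 p.2.2 r.2.1 r.2.2 a.2.1 a.2.2 b.2.1 b.2.2
      hp hr)

open Classical in
theorem exists_sum_inColumn_eq (f : LaverTable n → ℤ) :
    ∃ a : LaverTable n → ℤ, ∀ y, ∑ q, (if InColumn q.1 y then a q else 0) = f y :=
  @exists_sum_ite_le_eq _ _ (rightDvdOrder n) (fun _ _ => Classical.propDecidable _) f

open Classical in
theorem eq_zero_of_sum_inColumn_eq_zero {a : LaverTable n → ℤ}
    (h : ∀ y : LaverTable n, ∑ q : LaverTable n, (if InColumn q.1 y then a q else 0) = 0) : a = 0 :=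
  @eq_zero_of_sum_ite_le_eq_zero _ _ (rightDvdOrder n) (fun _ _ => Classical.propDecidable _) a h

open Classical in
/-- `ψ_{q,n}` is the coboundary of minus the indicator function of `{y | q ∈ column of y}`. -/
theorem psi_eq (q : ℕ) (x y : LaverTable n) :
    psi n q x y = (if InColumn q y then 1 else 0) - if InColumn q (op x y) then 1 else 0 := by
  have := @inColumn_of_inColumn_op n q x y
  unfold psi
  by_cases h1 : InColumn q y <;> by_cases h2 : InColumn q (op x y) <;> simp_all

theorem ofMap_psi_mem_coboundaries (q : ℕ) :
    RackComplex.ofMap (psi n q) ∈ RackComplex.coboundaries (op (n := n)) ℤ 2 := by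
  classical
  convert RackComplex.ofMap_sub_mem_coboundaries (op (n := n))
    (fun y => -(if InColumn q y then (1 : ℤ) else 0)) using 2
  funext x y
  rw [psi_eq]
  ring

theorem ofMap_psi_mem_cocycles (q : ℕ) :
    RackComplex.ofMap (psi n q) ∈ RackComplex.cocycles (op (n := n)) ℤ 2 := by
  rw [RackComplex.ofMap_mem_cocycles_iff]
  intro x y z
  simp only [psi_eq]
  rw [op_op x y z]
  ring

theorem ofMap_one_mem_cocycles :
    RackComplex.ofMap (fun _ _ => 1) ∈ RackComplex.cocycles (op (n := n)) ℤ 2 := by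
  rw [RackComplex.ofMap_mem_cocycles_iff]
  intros
  rfl

/-- A cocycle is determined by its values at the pairs `(x, 1)`, because
`φ(x, y ⋆ 1) = φ(x ⋆ y, x ⋆ 1) + φ(x, 1) - φ(y, 1)` with `x < x ⋆ y` unless `x = 2 ^ n`. -/
theorem eq_zero_of_cocycle {φ : LaverTable n → LaverTable n → ℤ}
    (h : ∀ x y z, φ (op x y) (op x z) + φ x z = φ x (op y z) + φ y z)
    (h1 : ∀ x, φ x (one n) = 0) (x y : LaverTable n) : φ x y = 0 := by
  induction hk : 2 ^ n - x.1 using Nat.strong_induction_on generalizing x y with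
  | _ k ih =>
    obtain ⟨r, rfl⟩ := exists_op_one_eq y
    have h2 := h x r (one n)
    rw [h1, h1, add_zero, add_zero] at h2
    rw [← h2]
    by_cases hx : x.1 < 2 ^ n
    · have := lt_op x r hx
      exact ih _ (by omega) _ _ rfl
    · have hx' := le_antisymm x.2.2 (not_lt.1 hx)
      rw [op_of_last x _ hx', op_of_last x _ hx', h1]

/-- A cocycle is a constant plus a coboundary. The values of `θ` are forced by those of `φ` at the
pairs `(x, 1)`, the constant by `φ(2 ^ n, 1)`. -/
theorem exists_eq_of_cocycle {φ : LaverTable n → LaverTable n → ℤ}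
    (h : ∀ x y z, φ (op x y) (op x z) + φ x z = φ x (op y z) + φ y z) :
    ∃ (c : ℤ) (θ : LaverTable n → ℤ), ∀ x y, φ x y = c + (θ (op x y) - θ y) := by
  choose g hg using exists_op_one_eq (n := n)
  have hinj : ∀ x, g (op x (one n)) = x := by
    have : Function.Surjective fun x : LaverTable n => op x (one n) := exists_op_one_eq
    exact fun x => Finite.injective_iff_surjective.2 this (hg _)
  refine ⟨φ (last n) (one n), fun y => φ (g y) (one n), fun x y => ?_⟩
  rw [← sub_eq_zero]
  refine eq_zero_of_cocycle (φ := fun x y =>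
    φ x y - (φ (last n) (one n) + (φ (g (op x y)) (one n) - φ (g y) (one n)))) ?_ ?_ x y
  · intro x y z
    simp only [op_op x y z]
    linear_combination h x y z
  · intro x
    have h2 := hinj (last n)
    rw [last_op] at h2
    simp only [hinj, h2]
    ring

/-! ### The basis of the module of cocycles -/

/-- The sums over `A_n` and over `{1, …, 2 ^ n - 1}` differ by the term at `2 ^ n`. -/
theorem sum_eq_sum_Ico_add (f : ℕ → ℤ) :
    ∑ q : LaverTable n, f q.1 = ∑ q : Set.Ico 1 (2 ^ n), f q.1 + f (2 ^ n) := by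
  have h1 : ∑ q : LaverTable n, f q.1 = ∑ q ∈ Finset.Icc 1 (2 ^ n), f q :=
    (Finset.sum_subtype _ (fun x => by simp) f).symm
  have h2 : ∑ q : Set.Ico 1 (2 ^ n), f q.1 = ∑ q ∈ Finset.Ico 1 (2 ^ n), f q :=
    (Finset.sum_subtype _ (fun x => by simp) f).symm
  rw [h1, h2, ← Finset.sum_Ico_add_eq_sum_Icc Nat.one_le_two_pow]

/-- The cocycles `ψ_{q,n}` for `1 ≤ q < 2 ^ n`, and the constant cocycle `1`. -/
noncomputable def cocycleFamily (n : ℕ) :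
    Option (Set.Ico 1 (2 ^ n)) → RackComplex.cocycles (op (n := n)) ℤ 2
  | some q => ⟨RackComplex.ofMap (psi n q), ofMap_psi_mem_cocycles q⟩
  | none => ⟨RackComplex.ofMap fun _ _ => 1, ofMap_one_mem_cocycles⟩

theorem sum_cocycleFamily_single (c : Option (Set.Ico 1 (2 ^ n)) → ℤ) (v : Fin 2 → LaverTable n) :
    (∑ i, c i • cocycleFamily n i).1 (Finsupp.single v 1) =
      c none + ∑ q : Set.Ico 1 (2 ^ n), c (some q) * psi n q (v 0) (v 1) := by
  simp [Fintype.sum_option, cocycleFamily]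

theorem linearIndependent_cocycleFamily (n : ℕ) : LinearIndependent ℤ (cocycleFamily n) := by
  classical
  rw [Fintype.linearIndependent_iff]
  intro c hc
  have h1 : ∀ x y, c none + ∑ q : Set.Ico 1 (2 ^ n), c (some q) * psi n q x y = 0 := by
    intro x y
    have := sum_cocycleFamily_single c ![x, y]
    rw [hc] at this
    exact this.symm
  have h2 : c none = 0 := by
    have := h1 (last n) (one n)
    simpa [psi_eq, last_op] using this
  -- Along `(x, 1)`, the cocycle `ψ_q` tells whether `q` is missing from the column of `x ⋆ 1`.
  have h3 : ∀ y : LaverTable n,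
      ∑ q : Set.Ico 1 (2 ^ n), c (some q) * (if InColumn q.1 y then 1 else 0) =
        ∑ q : Set.Ico 1 (2 ^ n), c (some q) := by
    intro y
    obtain ⟨x, rfl⟩ := exists_op_one_eq y
    have := h1 x (one n)
    simp only [psi_eq, h2, zero_add, mul_sub, Finset.sum_sub_distrib] at this
    rw [← sub_eq_zero.1 this]
    refine Finset.sum_congr rfl fun q _ => ?_
    rw [if_pos (inColumn_one q.2.1 q.2.2.le), mul_one]
  have h4 : ∑ q : Set.Ico 1 (2 ^ n), c (some q) = 0 := by
    rw [← h3 (last n)]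
    refine Finset.sum_eq_zero fun q _ => ?_
    rw [if_neg (fun h => q.2.2.ne (inColumn_last_iff.1 h)), mul_zero]
  let a : ℕ → ℤ := fun q => if h : q ∈ Set.Ico 1 (2 ^ n) then c (some ⟨q, h⟩) else 0
  have h5 : (fun q : LaverTable n => a q.1) = 0 := by
    refine eq_zero_of_sum_inColumn_eq_zero fun y => ?_
    rw [sum_eq_sum_Ico_add (fun q => if InColumn q y then a q else 0)]
    have : a (2 ^ n) = 0 := dif_neg (by simp)
    rw [this, ite_self, add_zero]
    refine (Finset.sum_congr rfl fun q _ => ?_).trans ((h3 y).trans h4)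
    rw [mul_ite, mul_one, mul_zero, show a q = c (some q) from dif_pos q.2]
  rintro (_ | q)
  · exact h2
  · have := congrFun h5 ⟨q.1, q.2.1, q.2.2.le⟩
    rwa [show a q = c (some q) from dif_pos q.2] at this

theorem top_le_span_cocycleFamily (n : ℕ) :
    ⊤ ≤ Submodule.span ℤ (Set.range (cocycleFamily n)) := by
  classical
  rintro ⟨φ, hφ⟩ -
  rw [← RackComplex.ofMap_eval φ, RackComplex.ofMap_mem_cocycles_iff] at hφ
  obtain ⟨k, θ, hk⟩ := exists_eq_of_cocycle (φ := fun x y => φ (Finsupp.single ![x, y] 1)) hφ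
  obtain ⟨a, ha⟩ := exists_sum_inColumn_eq θ
  let b : ℕ → ℤ := fun q => if h : q ∈ Set.Icc 1 (2 ^ n) then a ⟨q, h⟩ else 0
  have hb : ∀ y, θ y =
      ∑ q : Set.Ico 1 (2 ^ n), (if InColumn q.1 y then b q.1 else 0) + b (2 ^ n) := by
    intro y
    have := sum_eq_sum_Ico_add (n := n) (fun q => if InColumn q y then b q else 0)
    rw [if_pos (inColumn_pow y)] at this
    rw [← this, ← ha y]
    refine Finset.sum_congr rfl fun q _ => ?_
    rw [show b q = a q from dif_pos q.2]
  let c : Option (Set.Ico 1 (2 ^ n)) → ℤ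
    | none => k
    | some q => -b q.1
  rw [Submodule.mem_span_range_iff_exists_fun]
  refine ⟨c, Subtype.ext ?_⟩
  refine Finsupp.lhom_ext' fun v => LinearMap.ext_ring ?_
  rw [LinearMap.comp_apply, LinearMap.comp_apply, Finsupp.lsingle_apply, sum_cocycleFamily_single]
  change _ = φ (Finsupp.single v 1)
  rw [← RackComplex.ofMap_eval φ, RackComplex.ofMap_single, hk, hb, hb, add_sub_add_right_eq_sub,
    ← Finset.sum_sub_distrib]
  congr 1
  refine Finset.sum_congr rfl fun q _ => ?_
  rw [psi_eq]
  simp only [c]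
  split_ifs <;> ring

end LaverTable

theorem propositionP (n : ℕ) :
    Module.Free ℤ (RackComplex.cocycles (LaverTable.op (n := n)) ℤ 2) ∧
    Module.rank ℤ (RackComplex.cocycles (LaverTable.op (n := n)) ℤ 2) = 2 ^ n ∧
    (∀ q ∈ Set.Ico 1 (2 ^ n),
      RackComplex.ofMap (LaverTable.psi n q) ∈
        RackComplex.coboundaries (LaverTable.op (n := n)) ℤ 2) ∧
    ∃ b : Module.Basis (Option (Set.Ico 1 (2 ^ n))) ℤ
        (RackComplex.cocycles (LaverTable.op (n := n)) ℤ 2),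
      (∀ q : Set.Ico 1 (2 ^ n),
        (b (some q) : RackComplex.Cochain (LaverTable n) ℤ 2) =
          RackComplex.ofMap (LaverTable.psi n (q : ℕ))) ∧
      (b none : RackComplex.Cochain (LaverTable n) ℤ 2) = RackComplex.ofMap (fun _ _ => 1) := by
  let b := Module.Basis.mk (LaverTable.linearIndependent_cocycleFamily n)
    (LaverTable.top_le_span_cocycleFamily n)
  refine ⟨Module.Free.of_basis b, ?_, fun q _ => LaverTable.ofMap_psi_mem_coboundaries q, b,
    fun q => ?_, ?_⟩
  · have hcard : Fintype.card (Option (Set.Ico 1 (2 ^ n))) = 2 ^ n := by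
      have : 1 ≤ 2 ^ n := Nat.one_le_two_pow
      rw [Fintype.card_option, Fintype.card_ofFinset, Nat.card_Ico]
      omega
    rw [rank_eq_card_basis b, hcard]
    norm_cast
  · rw [Module.Basis.mk_apply]
    rfl
  · rw [Module.Basis.mk_apply]
    rfl
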